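/- Let $\mathcal W,\mathcal B\subset\mathbb R$ be finite, non-empty sets that are symmetric ($-\mathcal W=\mathcal W$, $-\mathcal B=\mathcal B$), let $N_w=|\mathcal W|$, and let $\alpha\in[0,1]$. Consider a random feedforward ReLU network of depth $L$ with input $z^{(0)}=x$ of arbitrary dimension and with layers $1,\dots,L$ of width $k$, $$h^{(\ell)}=W^{(\ell)}z^{(\ell)}+b^{(\ell)},\qquad z^{(\ell+1)}=\phi(h^{(\ell)}),\qquad 0\le \ell<L,$$ where $\phi(s)=\max(s,0)$ is applied entrywise. All entries of the weight matrices $W^{(\ell)}$ and of the bias vectors $b^{(\ell)}$ are mutually independent random variables; every weight is $0$ with probability $1-\alpha$ and is drawn uniformly from $\mathcal W$ with probability $\alpha$ (that is, it has law $\alpha\,\mathrm{Unif}(\mathcal W)+(1-\alpha)\delta_0$), and every bias is drawn uniformly from $\mathcal B$ (a sparse-discrete network). Let $x(t)$, $t\in[0,1]$, be a trajectory in input space that is differentiable at almost every $t$, let $z^{(d)}(t)$ be its image in layer $d$ of the network, and for such a trajectory $y$ let $l(y(t))=\int_0^1\left\|\frac{dy(t)}{dt}\right\|dt\in[0,\infty]$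 be its length in the Euclidean norm. Then for every $0\le d\le L$ the trajectory $z^{(d)}(t)$ is differentiable at almost every $t\in[0,1]$ for every realization of the network, its length is a random variable (measurable up to a null set), and $$\mathbb E\left[l(z^{(d)}(t))\right]\ \ge\ \left(\frac{\alpha\sqrt k}{2\sqrt 2}\cdot\frac{\sum_{w\in\mathcal W}|w|}{N_w}\right)^{d}\, l(x(t)).$$ -/

import Mathlib

open MeasureTheory ProbabilityTheory
open scoped ENNReal Matrix

namespace ReLUNet

noncomputable section

/-- The ReLU activation `φ(x) = max(x, 0)`. -/
def relu (x : ℝ) : ℝ := max x 0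

/-- Weight matrices of a feedforward network whose `ℓ`-th layer has width `m ℓ`
(`m 0` is the dimension of the input): the `ℓ`-th matrix maps layer `ℓ` to layer `ℓ + 1`. -/
abbrev Weights (m : ℕ → ℕ) : Type := (ℓ : ℕ) → Matrix (Fin (m (ℓ + 1))) (Fin (m ℓ)) ℝ

/-- Bias vectors of a feedforward network with layer widths `m`. -/
abbrev Biases (m : ℕ → ℕ) : Type := (ℓ : ℕ) → Fin (m (ℓ + 1)) → ℝ

/-- The pre-activation `h = A z + c`. -/
def preActivation {p q : ℕ} (A : Matrix (Fin q) (Fin p) ℝ) (c : Fin q → ℝ)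
    (z : EuclideanSpace ℝ (Fin p)) : Fin q → ℝ :=
  A *ᵥ z.ofLp + c

/-- The post-activation layers of the network with input `x`:
`z⁽⁰⁾ = x` and `z⁽ᵈ⁺¹⁾ = φ(h⁽ᵈ⁾)`, `h⁽ᵈ⁾ = W⁽ᵈ⁾ z⁽ᵈ⁾ + b⁽ᵈ⁾`, with `φ` applied entrywise. -/
def layer {m : ℕ → ℕ} (W : Weights m) (b : Biases m) (x : EuclideanSpace ℝ (Fin (m 0))) :
    (d : ℕ) → EuclideanSpace ℝ (Fin (m d))
  | 0 => x
  | d + 1 => WithLp.toLp 2 fun i => relu (preActivation (W d) (b d) (layer W b x d) i)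

/-- The length `∫₀¹ ‖dx/dt‖ dt ∈ [0, ∞]` of a trajectory. -/
def trajectoryLength {n : ℕ} (x : ℝ → EuclideanSpace ℝ (Fin n)) : ℝ≥0∞ :=
  ∫⁻ t in Set.Icc (0 : ℝ) 1, ‖deriv x t‖ₑ

/-- `x` has a derivative at almost every time in `[0, 1]`, so that its length is meaningful. -/
def AEDifferentiable {n : ℕ} (x : ℝ → EuclideanSpace ℝ (Fin n)) : Prop :=
  ∀ᵐ t ∂(volume.restrict (Set.Icc (0 : ℝ) 1)), DifferentiableAt ℝ x t

/-- The mixture `α P + (1 - α) δ₀`. -/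
def sparseLaw (α : ℝ) (P : Measure ℝ) : Measure ℝ :=
  ENNReal.ofReal α • P + ENNReal.ofReal (1 - α) • Measure.dirac 0

/-- All scalar weights and biases in front of the layers `1, …, L`, as one family of
real random variables. -/
def parameters {Ω : Type*} {m : ℕ → ℕ} (L : ℕ) (W : Ω → Weights m) (b : Ω → Biases m) :
    ((Σ ℓ : Fin L, Fin (m (ℓ + 1)) × Fin (m ℓ)) ⊕ (Σ ℓ : Fin L, Fin (m (ℓ + 1)))) → Ω → ℝ
  | .inl p => fun ω => W ω p.1 p.2.1 p.2.2
  | .inr p => fun ω => b ω p.1 p.2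

/-- A random sparse network of depth `L` with sparsity parameter `α`: all its weights and biases
are mutually independent, every weight has law `α P + (1 - α) δ₀`, every bias has law `Q`. -/
structure IsRandomSparseNetwork {Ω : Type*} [MeasurableSpace Ω] {m : ℕ → ℕ} (L : ℕ)
    (W : Ω → Weights m) (b : Ω → Biases m) (α : ℝ) (P Q : Measure ℝ) (μ : Measure Ω) : Prop where
  indep : iIndepFun (parameters L W b) μ
  weight_law : ∀ ℓ < L, ∀ i j, HasLaw (fun ω => W ω ℓ i j) (sparseLaw α P) μ
  bias_law : ∀ ℓ < L, ∀ i, HasLaw (fun ω => b ω ℓ i) Q μ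

end

end ReLUNet

/-! At almost every time each layer moves with the velocity given by the chain rule with φ' =
1_{(0,∞)}: the kink of φ matters only where a pre-activation vanishes with nonzero derivative, and
such times are countable (`ae_hasDerivAt_layer`). With discrete laws a pre-activation may vanish
with positive probability, so this argument takes the place of "h ≠ 0 almost surely". By Tonelli it
then suffices to bound the expected speed at almost every fixed time.

Consider one neuron with incoming velocity v and weight row w. Negating the row and the bias negates
both h and ⟨w, v⟩, so the event h > 0 carries exactly half of E|⟨w, v⟩|. Random signs, Khintchine's
inequality with constant 1/√2 (`khintchine`) and independence of w from v give E|⟨w, v⟩| ≥ E|w| E‖v‖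
/ √2; together this is `le_lintegral_neuron`. Summing over k neurons gains k, and passing from the
ℓ¹ norm to the Euclidean norm costs √k, so each layer contributes the factor √k E|w| / (2√2)
(`le_lintegral_layerVelocity_succ`), where E|w| is α times the mean of |w| over the weight set.

Khintchine's inequality comes from the spectral gap of even functions on the cube (`poincare_cube`),
applied to |∑ ±aᵢ|. -/

namespace ReLUNet

/-! ### The Dirichlet form and a Poincaré inequality on the discrete cube. -/

/-- The vertex of the cube obtained from `s` by flipping the `i`-th bit. -/
def flipBit {n : ℕ} (i : Fin n) (s : Fin n → Bool) : Fin n → Bool :=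
  Function.update s i (!s i)

/-- The sign `±1` encoded by a bit. -/
def bitSign (c : Bool) : ℝ := if c then -1 else 1

/-- The (unnormalized) Dirichlet form of a function on the discrete cube. -/
def dirichletForm {n : ℕ} (f : (Fin n → Bool) → ℝ) : ℝ :=
  ∑ s, ∑ i, f s * (f s - f (flipBit i s))

lemma bitSign_not (c : Bool) : bitSign (!c) = -bitSign c := by
  cases c <;> simp [bitSign]

lemma sum_cube_succ {n : ℕ} (g : (Fin (n + 1) → Bool) → ℝ) :
    ∑ s, g s = ∑ s : Fin n → Bool, (g (Fin.cons true s) + g (Fin.cons false s)) := by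
  rw [← (Fin.consEquiv fun _ : Fin (n + 1) => Bool).sum_comp, Fintype.sum_prod_type,
    Fintype.sum_bool, ← Finset.sum_add_distrib]
  rfl

lemma sum_cube_compl {n : ℕ} (g : (Fin n → Bool) → ℝ) : ∑ s, g sᶜ = ∑ s, g s :=
  Function.Involutive.bijective (compl_compl (α := Fin n → Bool)) |>.sum_comp g

lemma cons_compl {n : ℕ} (c : Bool) (s : Fin n → Bool) :
    (Fin.cons c s : Fin (n + 1) → Bool)ᶜ = Fin.cons (!c) sᶜ := by
  ext i
  refine Fin.cases ?_ (fun j => ?_) i <;> simp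

lemma flipBit_zero_cons {n : ℕ} (c : Bool) (s : Fin n → Bool) :
    flipBit 0 (Fin.cons c s : Fin (n + 1) → Bool) = Fin.cons (!c) s := by
  simp [flipBit]

lemma flipBit_succ_cons {n : ℕ} (i : Fin n) (c : Bool) (s : Fin n → Bool) :
    flipBit i.succ (Fin.cons c s : Fin (n + 1) → Bool) = Fin.cons c (flipBit i s) := by
  simp [flipBit, Fin.cons_update]

/-- Edges in direction 0 join the two half-cubes and, counted from both ends, give the squares; all
other edges stay inside one half. -/
lemma dirichletForm_succ {n : ℕ} (f : (Fin (n + 1) → Bool) → ℝ) :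
    dirichletForm f = dirichletForm (fun s => f (Fin.cons true s)) +
      dirichletForm (fun s => f (Fin.cons false s)) +
      ∑ s, (f (Fin.cons true s) - f (Fin.cons false s)) ^ 2 := by
  simp only [dirichletForm, sum_cube_succ, Fin.sum_univ_succ, flipBit_zero_cons,
    flipBit_succ_cons, Finset.sum_add_distrib, Bool.not_true, Bool.not_false]
  have : ∑ s, (f (Fin.cons true s) - f (Fin.cons false s)) ^ 2 =
      ∑ s, f (Fin.cons true s) * (f (Fin.cons true s) - f (Fin.cons false s)) +
      ∑ s, f (Fin.cons false s) * (f (Fin.cons false s) - f (Fin.cons true s)) := by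
    rw [← Finset.sum_add_distrib]
    exact Finset.sum_congr rfl fun s _ => by ring
  rw [this]
  ring

lemma dirichletForm_parallelogram {n : ℕ} (f g : (Fin n → Bool) → ℝ) :
    dirichletForm (fun s => f s + g s) + dirichletForm (fun s => f s - g s) =
      2 * (dirichletForm f + dirichletForm g) := by
  simp only [dirichletForm, Finset.mul_sum, ← Finset.sum_add_distrib]
  refine Finset.sum_congr rfl fun s _ => Finset.sum_congr rfl fun i _ => ?_
  ring

/-- A Poincaré inequality on the discrete cube: for even functions the spectral gap is twice
as large as for general functions. -/
theorem poincare_cube {n : ℕ} (f : (Fin n → Bool) → ℝ) :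
    3 * ∑ s, f s ^ 2 + ∑ s, f s * f sᶜ ≤ dirichletForm f + 4 * (∑ s, f s) ^ 2 / 2 ^ n := by
  -- On a Walsh character of degree j the claim reads 3 + (-1)^j ≤ 2j for j ≥ 1, with equality at j
  -- = 1, 2; the last term covers j = 0. The induction avoids the Fourier expansion.
  induction n with
  | zero =>
    obtain ⟨c, rfl⟩ : ∃ c, f = fun _ => c :=
      ⟨f fun _ => true, funext fun s => congrArg f (Subsingleton.elim _ _)⟩
    simp only [dirichletForm, Fintype.sum_unique, Finset.univ_eq_empty, Finset.sum_empty]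
    apply le_of_eq
    ring
  | succ n ih =>
    set a : (Fin n → Bool) → ℝ := fun s => f (Fin.cons true s)
    set b : (Fin n → Bool) → ℝ := fun s => f (Fin.cons false s)
    -- Half the sum of these two instances, rewritten by the parallelogram law, leaves exactly the
    -- deficit bounded by `hc`.
    have h₁ := ih fun s => a s + b s
    have h₂ := ih fun s => a s - b s
    have h₃ := dirichletForm_parallelogram a b
    have h₄ : ∑ s, f s ^ 2 = ∑ s, a s ^ 2 + ∑ s, b s ^ 2 := by
      rw [sum_cube_succ, Finset.sum_add_distrib]
    have h₅ : ∑ s, f s * f sᶜ = 2 * ∑ s, a s * b sᶜ := by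
      rw [sum_cube_succ, Finset.sum_add_distrib]
      simp only [cons_compl, Bool.not_true, Bool.not_false]
      rw [two_mul]
      congr 1
      rw [← sum_cube_compl]
      exact Finset.sum_congr rfl fun s _ => by rw [compl_compl, mul_comm]
    have h₆ : ∑ s, f s = ∑ s, a s + ∑ s, b s := by
      rw [sum_cube_succ, Finset.sum_add_distrib]
    have h₇ : dirichletForm f = dirichletForm a + dirichletForm b +
        ∑ s, (a s - b s) ^ 2 := dirichletForm_succ f
    have h₈ : ∑ s, b s * a sᶜ = ∑ s, a s * b sᶜ := by
      rw [← sum_cube_compl]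
      exact Finset.sum_congr rfl fun s _ => by rw [compl_compl, mul_comm]
    have h₁₂ : ∑ s, a sᶜ = ∑ s, a s := sum_cube_compl a
    have h₁₃ : ∑ s, b sᶜ = ∑ s, b s := sum_cube_compl b
    -- Cauchy–Schwarz for twice the even part of `a - b`.
    have hc : (∑ s, ((a s - b s) + (a sᶜ - b sᶜ))) ^ 2 / 2 ^ n ≤
        ∑ s, ((a s - b s) + (a sᶜ - b sᶜ)) ^ 2 := by
      rw [div_le_iff₀' (by positivity)]
      simpa using sq_sum_le_card_mul_sum_sq (s := Finset.univ)
        (f := fun s : Fin n → Bool => (a s - b s) + (a sᶜ - b sᶜ))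
    have e₁ : ∑ s, (a s + b s) ^ 2 = ∑ s, a s ^ 2 + 2 * ∑ s, a s * b s + ∑ s, b s ^ 2 := by
      simp only [Finset.mul_sum, ← Finset.sum_add_distrib]
      exact Finset.sum_congr rfl fun s _ => by ring
    have e₂ : ∑ s, (a s - b s) ^ 2 = ∑ s, a s ^ 2 - 2 * ∑ s, a s * b s + ∑ s, b s ^ 2 := by
      simp only [Finset.mul_sum, ← Finset.sum_add_distrib, ← Finset.sum_sub_distrib]
      exact Finset.sum_congr rfl fun s _ => by ring
    have e₃ : ∑ s, (a s + b s) * (a sᶜ + b sᶜ) =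
        ∑ s, a s * a sᶜ + ∑ s, a s * b sᶜ + ∑ s, b s * a sᶜ + ∑ s, b s * b sᶜ := by
      simp only [← Finset.sum_add_distrib]
      exact Finset.sum_congr rfl fun s _ => by ring
    have e₄ : ∑ s, (a s - b s) * (a sᶜ - b sᶜ) =
        ∑ s, a s * a sᶜ - ∑ s, a s * b sᶜ - ∑ s, b s * a sᶜ + ∑ s, b s * b sᶜ := by
      simp only [← Finset.sum_add_distrib, ← Finset.sum_sub_distrib]
      exact Finset.sum_congr rfl fun s _ => by ring
    have e₅ : ∑ s, ((a s - b s) + (a sᶜ - b sᶜ)) ^ 2 =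
        2 * ∑ s, (a s - b s) ^ 2 + 2 * ∑ s, (a s - b s) * (a sᶜ - b sᶜ) := by
      have : ∑ s, (a sᶜ - b sᶜ) ^ 2 = ∑ s, (a s - b s) ^ 2 :=
        sum_cube_compl fun s => (a s - b s) ^ 2
      rw [two_mul (∑ s, (a s - b s) ^ 2)]
      nth_rewrite 2 [← this]
      simp only [Finset.mul_sum, ← Finset.sum_add_distrib]
      exact Finset.sum_congr rfl fun s _ => by ring
    have e₆ : ∑ s, ((a s - b s) + (a sᶜ - b sᶜ)) = 2 * (∑ s, a s - ∑ s, b s) := by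
      rw [Finset.sum_add_distrib, Finset.sum_sub_distrib, Finset.sum_sub_distrib, h₁₂, h₁₃]
      ring
    have l₁ : ∑ s, (a s + b s) = ∑ s, a s + ∑ s, b s := Finset.sum_add_distrib
    have l₂ : ∑ s, (a s - b s) = ∑ s, a s - ∑ s, b s := Finset.sum_sub_distrib _ _
    rw [e₅, e₆, e₄] at hc
    rw [e₁, e₃, l₁] at h₁
    rw [e₂] at hc h₇
    rw [e₂, e₄, l₂] at h₂
    rw [h₄, h₅, h₆, h₇]
    have d₁ : 4 * (∑ s, a s + ∑ s, b s) ^ 2 / 2 ^ (n + 1) =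
        2 * ((∑ s, a s + ∑ s, b s) ^ 2 / 2 ^ n) := by rw [pow_succ]; field_simp; ring
    rw [d₁]
    rw [mul_pow, mul_div_assoc] at hc
    rw [mul_div_assoc] at h₁ h₂
    linarith

/-! ### Khintchine's inequality for signed sums. -/

/-- The signed sum `∑ ±aᵢ`. -/
def signedSum {n : ℕ} (a : Fin n → ℝ) (s : Fin n → Bool) : ℝ := ∑ i, bitSign (s i) * a i

lemma signedSum_flipBit {n : ℕ} (a : Fin n → ℝ) (s : Fin n → Bool) (i : Fin n) :
    signedSum a (flipBit i s) = signedSum a s - 2 * (bitSign (s i) * a i) := by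
  have : ∑ j, (bitSign (s j) * a j - bitSign (flipBit i s j) * a j) =
      2 * (bitSign (s i) * a i) := by
    rw [Finset.sum_eq_single i]
    · simp only [flipBit, Function.update_self, bitSign_not]
      ring
    · intro j _ hj
      simp [flipBit, Function.update_of_ne hj]
    · simp
  rw [Finset.sum_sub_distrib] at this
  simp only [signedSum]
  linarith

lemma signedSum_compl {n : ℕ} (a : Fin n → ℝ) (s : Fin n → Bool) :
    signedSum a sᶜ = -signedSum a s := by
  simp [signedSum, bitSign_not]

lemma sum_signedSum_sq {n : ℕ} (a : Fin n → ℝ) :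
    ∑ s, signedSum a s ^ 2 = 2 ^ n * ∑ i, a i ^ 2 := by
  induction n with
  | zero => simp [signedSum]
  | succ n ih =>
    have h (c : Bool) (s : Fin n → Bool) : signedSum a (Fin.cons c s) =
        bitSign c * a 0 + signedSum (fun i => a i.succ) s := by
      simp [signedSum, Fin.sum_univ_succ]
    rw [sum_cube_succ, Fin.sum_univ_succ]
    have := ih fun i => a i.succ
    calc _ = ∑ s : Fin n → Bool, (2 * a 0 ^ 2 + 2 * signedSum (fun i => a i.succ) s ^ 2) := by
          refine Finset.sum_congr rfl fun s _ => ?_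
          rw [h, h]
          simp only [bitSign, if_true, Bool.false_eq_true, if_false]
          ring
      _ = _ := by
          rw [Finset.sum_add_distrib, ← Finset.mul_sum, ← Finset.mul_sum, this]
          simp
          ring

/-- The n single flips of a signed sum S add up to (n - 2) S, so by the triangle inequality their
absolute values add up to at least (n - 2)|S|; the constant 2 is n - (n - 2). -/
lemma dirichletForm_abs_signedSum_le {n : ℕ} (a : Fin n → ℝ) :
    dirichletForm (fun s => |signedSum a s|) ≤ 2 * ∑ s, |signedSum a s| ^ 2 := by
  rw [dirichletForm, Finset.mul_sum]
  refine Finset.sum_le_sum fun s _ => ?_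
  rw [← Finset.mul_sum, Finset.sum_sub_distrib]
  have h₁ : ∑ i, signedSum a (flipBit i s) = (n - 2) * signedSum a s := by
    simp only [signedSum_flipBit, Finset.sum_sub_distrib, ← Finset.mul_sum]
    simp only [Finset.sum_const, Finset.card_univ, Fintype.card_fin, nsmul_eq_mul]
    rw [show ∑ i, bitSign (s i) * a i = signedSum a s from rfl]
    ring
  have h₂ : ((n : ℝ) - 2) * |signedSum a s| ≤ ∑ i, |signedSum a (flipBit i s)| := by
    refine le_trans ?_ (Finset.abs_sum_le_sum_abs _ _)
    rw [h₁, abs_mul]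
    exact mul_le_mul_of_nonneg_right (le_abs_self _) (abs_nonneg _)
  have h₃ : ∑ _i : Fin n, |signedSum a s| = n * |signedSum a s| := by simp
  rw [h₃]
  nlinarith [abs_nonneg (signedSum a s)]

/-- **Khintchine's inequality** in `L¹` with Szarek's optimal constant `1/√2`. -/
theorem khintchine {n : ℕ} (a : Fin n → ℝ) :
    2 ^ n * √(∑ i, a i ^ 2) ≤ √2 * ∑ s, |signedSum a s| := by
  -- The absolute value is even, so the left side becomes four times the second moment; the
  -- Dirichlet form absorbs half of it.
  have h₁ := poincare_cube fun s => |signedSum a s|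
  have h₂ := dirichletForm_abs_signedSum_le a
  simp only [signedSum_compl, abs_neg, ← sq] at h₁
  have h₃ : ∑ s, |signedSum a s| ^ 2 = 2 ^ n * ∑ i, a i ^ 2 := by
    simp only [sq_abs, sum_signedSum_sq]
  rw [h₃] at h₁ h₂
  have h₄ : 2 ^ n * (2 ^ n * ∑ i, a i ^ 2) ≤ 2 * (∑ s, |signedSum a s|) ^ 2 := by
    have : 2 ^ n * ∑ i, a i ^ 2 ≤ 2 * (∑ s, |signedSum a s|) ^ 2 / 2 ^ n := by
      rw [mul_div_assoc] at h₁ ⊢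
      linarith
    rwa [le_div_iff₀' (by positivity)] at this
  have h₅ : 0 ≤ ∑ s, |signedSum a s| := Finset.sum_nonneg fun s _ => abs_nonneg _
  have h₆ : 0 ≤ ∑ i, a i ^ 2 := Finset.sum_nonneg fun i _ => sq_nonneg _
  refine le_of_sq_le_sq ?_ (by positivity)
  rw [mul_pow, mul_pow, Real.sq_sqrt h₆, Real.sq_sqrt (by norm_num)]
  linarith [h₄, mul_assoc ((2 : ℝ) ^ n) (2 ^ n) (∑ i, a i ^ 2), sq ((2 : ℝ) ^ n)]

/-! ### Differentiating a trajectory through the layers. -/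

/-- A real function has a zero with nonvanishing derivative at only countably many points. -/
lemma countable_transversal_zeros (g g' : ℝ → ℝ) :
    {t | HasDerivAt g (g' t) t ∧ g t = 0 ∧ g' t ≠ 0}.Countable := by
  set s := {t | HasDerivAt g (g' t) t ∧ g t = 0 ∧ g' t ≠ 0}
  -- A nonzero derivative keeps `g` off 0 in a punctured neighbourhood, so every point of `s` is
  -- isolated from the right, and a real set has only countably many such points.
  suffices h : s ⊆ {t ∈ s | nhdsWithin t (s ∩ Set.Ioi t) = ⊥} from
    Set.Countable.mono h countable_setOfPred_isolated_right_within
  intro t ht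
  refine ⟨ht, ?_⟩
  have h := (ht.1.eventually_ne (c := 0) ht.2.2).filter_mono
    (nhdsWithin_mono t (show s ∩ Set.Ioi t ⊆ {t}ᶜ from fun y hy => ne_of_gt hy.2))
  rw [← Filter.eventually_false_iff_eq_bot]
  filter_upwards [h, self_mem_nhdsWithin] with y hy hys
  exact hy hys.1.2.1

/-- At a zero with `g' = 0` the kink is harmless: |relu (g s)| ≤ |g s| is already o(s - t). -/
lemma hasDerivAt_relu_comp {g : ℝ → ℝ} {g' t : ℝ} (hg : HasDerivAt g g' t)
    (h : g t = 0 → g' = 0) :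
    HasDerivAt (fun s => relu (g s)) (if 0 < g t then g' else 0) t := by
  rcases lt_trichotomy (g t) 0 with h0 | h0 | h0
  · rw [if_neg h0.not_gt]
    refine (hasDerivAt_const t (0 : ℝ)).congr_of_eventuallyEq ?_
    filter_upwards [hg.continuousAt.eventually_lt_const h0] with s hs
    exact max_eq_right hs.le
  · rw [if_neg h0.not_gt]
    have h1 := h h0
    subst h1
    rw [hasDerivAt_iff_isLittleO] at hg ⊢
    refine Asymptotics.IsBigO.trans_isLittleO (Asymptotics.isBigO_of_le _ fun s => ?_) hg
    simp only [h0, relu, smul_zero, sub_zero, max_self, Real.norm_eq_abs]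
    rw [abs_of_nonneg (le_max_right _ _)]
    exact max_le (le_abs_self _) (abs_nonneg _)
  · rw [if_pos h0]
    refine hg.congr_of_eventuallyEq ?_
    filter_upwards [hg.continuousAt.eventually_const_lt h0] with s hs
    exact max_eq_left hs.le

lemma hasDerivAt_euclidean {n : ℕ} {f : ℝ → EuclideanSpace ℝ (Fin n)}
    {f' : EuclideanSpace ℝ (Fin n)} {t : ℝ} :
    HasDerivAt f f' t ↔ ∀ i, HasDerivAt (fun s => f s i) (f' i) t := by
  simp only [hasDerivAt_iff_hasFDerivAt]
  rw [← hasFDerivWithinAt_univ, hasFDerivWithinAt_euclidean]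
  refine forall_congr' fun i => ?_
  rw [hasFDerivWithinAt_univ]
  congr! 1

/-- The velocity of the trajectory in layer `d` when the input passes through `x` with
velocity `v`, computed by the chain rule with `φ' = 1_{(0, ∞)}`. -/
noncomputable def layerVelocity {m : ℕ → ℕ} (W : Weights m) (b : Biases m)
    (x v : EuclideanSpace ℝ (Fin (m 0))) : (d : ℕ) → EuclideanSpace ℝ (Fin (m d))
  | 0 => v
  | d + 1 => WithLp.toLp 2 fun i =>
      if 0 < preActivation (W d) (b d) (layer W b x d) i
      then (W d *ᵥ (layerVelocity W b x v d).ofLp) i else 0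

lemma hasDerivAt_preActivation {p q : ℕ} (A : Matrix (Fin q) (Fin p) ℝ) (c : Fin q → ℝ)
    {z : ℝ → EuclideanSpace ℝ (Fin p)} {v : EuclideanSpace ℝ (Fin p)} {t : ℝ}
    (hz : HasDerivAt z v t) (i : Fin q) :
    HasDerivAt (fun s => preActivation A c (z s) i) ((A *ᵥ v.ofLp) i) t := by
  have h : ∀ j, HasDerivAt (fun s => z s j) (v j) t := fun j =>
    (hasDerivAt_euclidean.1 hz) j
  simp only [preActivation, Pi.add_apply, Matrix.mulVec, dotProduct]
  exact (HasDerivAt.fun_sum fun j _ => (h j).const_mul (A i j)).add_const _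

/-- For almost every time the trajectory is differentiable in every layer, with derivative given
by the chain rule, and crosses no hyperplane `h = 0` transversally. -/
lemma ae_hasDerivAt_layer {m : ℕ → ℕ} (W : Weights m) (b : Biases m)
    {x : ℝ → EuclideanSpace ℝ (Fin (m 0))} (hx : AEDifferentiable x) (d : ℕ) :
    ∀ᵐ t ∂(volume.restrict (Set.Icc (0 : ℝ) 1)),
      HasDerivAt (fun s => layer W b (x s) d) (layerVelocity W b (x t) (deriv x t) d) t ∧
      ∀ i, preActivation (W d) (b d) (layer W b (x t) d) i = 0 →
        (W d *ᵥ (layerVelocity W b (x t) (deriv x t) d).ofLp) i = 0 := by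
  -- The exceptional times are countable for each neuron, hence null. This is the hypothesis that
  -- `hasDerivAt_relu_comp` needs to reach the next layer.
  have key (d : ℕ) (h : ∀ᵐ t ∂(volume.restrict (Set.Icc (0 : ℝ) 1)),
      HasDerivAt (fun s => layer W b (x s) d) (layerVelocity W b (x t) (deriv x t) d) t) :
      ∀ᵐ t ∂(volume.restrict (Set.Icc (0 : ℝ) 1)),
      ∀ i, preActivation (W d) (b d) (layer W b (x t) d) i = 0 →
        (W d *ᵥ (layerVelocity W b (x t) (deriv x t) d).ofLp) i = 0 := by
    rw [ae_all_iff]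
    intro i
    filter_upwards [h, (countable_transversal_zeros
      (fun t => preActivation (W d) (b d) (layer W b (x t) d) i)
      (fun t => (W d *ᵥ (layerVelocity W b (x t) (deriv x t) d).ofLp) i)).ae_notMem _]
      with t ht hn h0
    by_contra hne
    exact hn ⟨hasDerivAt_preActivation _ _ ht i, h0, hne⟩
  induction d with
  | zero =>
    have h : ∀ᵐ t ∂(volume.restrict (Set.Icc (0 : ℝ) 1)),
        HasDerivAt (fun s => layer W b (x s) 0) (layerVelocity W b (x t) (deriv x t) 0) t :=
      hx.mono fun t ht => ht.hasDerivAt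
    exact h.and (key 0 h)
  | succ d ih =>
    have h : ∀ᵐ t ∂(volume.restrict (Set.Icc (0 : ℝ) 1)),
        HasDerivAt (fun s => layer W b (x s) (d + 1))
          (layerVelocity W b (x t) (deriv x t) (d + 1)) t := by
      filter_upwards [ih] with t ht
      rw [hasDerivAt_euclidean]
      exact fun i => hasDerivAt_relu_comp (hasDerivAt_preActivation _ _ ht.1 i) (ht.2 i)
    exact h.and (key _ h)

/-- Layer `d` reads only the parameters with index below `d`. This makes it independent of row `d`
and insensitive to how parameters are extended beyond depth `L`. -/
lemma layer_congr {m : ℕ → ℕ} {W W' : Weights m} {b b' : Biases m} {d : ℕ}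
    (hW : ∀ ℓ < d, W ℓ = W' ℓ) (hb : ∀ ℓ < d, b ℓ = b' ℓ) (x : EuclideanSpace ℝ (Fin (m 0))) :
    layer W b x d = layer W' b' x d := by
  induction d with
  | zero => rfl
  | succ d ih =>
    simp only [layer]
    rw [ih (fun ℓ h => hW ℓ (by omega)) (fun ℓ h => hb ℓ (by omega)), hW d (by omega),
      hb d (by omega)]

lemma layerVelocity_congr {m : ℕ → ℕ} {W W' : Weights m} {b b' : Biases m} {d : ℕ}
    (hW : ∀ ℓ < d, W ℓ = W' ℓ) (hb : ∀ ℓ < d, b ℓ = b' ℓ)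
    (x v : EuclideanSpace ℝ (Fin (m 0))) :
    layerVelocity W b x v d = layerVelocity W' b' x v d := by
  induction d with
  | zero => rfl
  | succ d ih =>
    simp only [layerVelocity]
    rw [ih (fun ℓ h => hW ℓ (by omega)) (fun ℓ h => hb ℓ (by omega)), hW d (by omega),
      hb d (by omega), layer_congr (fun ℓ h => hW ℓ (by omega)) (fun ℓ h => hb ℓ (by omega))]

/-- An almost everywhere differentiable trajectory is almost everywhere measurable. -/
lemma AEDifferentiable.aemeasurable {n : ℕ} {x : ℝ → EuclideanSpace ℝ (Fin n)}
    (hx : AEDifferentiable x) : AEMeasurable x (volume.restrict (Set.Icc (0 : ℝ) 1)) := by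
  have hD := measurableSet_of_differentiableAt ℝ x
  have hc : ContinuousOn x {t | DifferentiableAt ℝ x t} :=
    fun t ht => ht.continuousAt.continuousWithinAt
  have := hc.aemeasurable (μ := volume.restrict (Set.Icc (0 : ℝ) 1)) hD
  rwa [Measure.restrict_eq_self_of_ae_mem (s := {t | DifferentiableAt ℝ x t}) hx] at this

/-! ### Independence and sign symmetry under product measures. -/

/-- Under a product probability measure, a function of one coordinate is independent of a
function of the other coordinates. -/
lemma lintegral_pi_mul_of_update_eq {I : Type*} [Fintype I] [DecidableEq I] (ρ : I → Measure ℝ)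
    [∀ i, IsProbabilityMeasure (ρ i)] (i : I) {f : ℝ → ℝ≥0∞} (hf : Measurable f)
    {g : (I → ℝ) → ℝ≥0∞} (hg : Measurable g) (hgi : ∀ p c, g (Function.update p i c) = g p) :
    ∫⁻ p, f (p i) * g p ∂Measure.pi ρ = (∫⁻ c, f c ∂ρ i) * ∫⁻ p, g p ∂Measure.pi ρ := by
  have key (f : ℝ → ℝ≥0∞) (hf : Measurable f) : ∫⁻ p, f (p i) * g p ∂Measure.pi ρ =
      (∫⋯∫⁻_(Finset.univ.erase i), (fun p => (∫⁻ c, f c ∂ρ i) * g p) ∂ρ) 0 := by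
    rw [lintegral_eq_lmarginal_univ (μ := ρ) 0, lmarginal_erase' _ (by fun_prop)
      (Finset.mem_univ i)]
    simp only [Function.update_self, hgi]
    simp only [lintegral_mul_const _ hf]
  -- The case `f = 1` identifies the marginal over the remaining coordinates with the integral of
  -- `g`.
  have h₁ := key (fun _ => 1) measurable_const
  simp only [one_mul, lintegral_const, measure_univ, mul_one] at h₁
  rw [key f hf, h₁]
  simp only [lmarginal]
  exact lintegral_const_mul _ (hg.comp (measurable_updateFinset))

/-- A product of symmetric laws is invariant under sign changes of the coordinates. -/
lemma measurePreserving_pi_sign {I : Type*} [Fintype I] (ρ : I → Measure ℝ)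
    [∀ i, IsProbabilityMeasure (ρ i)] (hρ : ∀ i, (ρ i).map Neg.neg = ρ i) (σ : I → Bool) :
    MeasurePreserving (fun p i => bitSign (σ i) * p i) (Measure.pi ρ) (Measure.pi ρ) := by
  refine measurePreserving_pi ρ ρ fun i => ⟨by fun_prop, ?_⟩
  cases h : σ i
  · rw [show (HMul.hMul (bitSign false) : ℝ → ℝ) = id by ext; simp [bitSign]]
    exact Measure.map_id
  · rw [show (HMul.hMul (bitSign true) : ℝ → ℝ) = Neg.neg by ext; simp [bitSign]]
    exact hρ i

/-- The sign change acting on the coordinates `e j` by `s j` and on `i₀` by `c`. -/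
noncomputable def rowSigns {I : Type*} [DecidableEq I] {n : ℕ} (e : Fin n → I) (i₀ : I)
    (s : Fin n → Bool) (c : Bool) (i : I) : Bool :=
  if h : ∃ j, e j = i then s h.choose else if i = i₀ then c else false

lemma rowSigns_apply {I : Type*} [DecidableEq I] {n : ℕ} {e : Fin n → I} {i₀ : I}
    (he : Function.Injective e) (s : Fin n → Bool) (c : Bool) (j : Fin n) :
    rowSigns e i₀ s c (e j) = s j := by
  have h : ∃ j', e j' = e j := ⟨j, rfl⟩
  rw [rowSigns, dif_pos h, he h.choose_spec]

lemma rowSigns_bias {I : Type*} [DecidableEq I] {n : ℕ} {e : Fin n → I} {i₀ : I}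
    (hi₀ : ∀ j, e j ≠ i₀) (s : Fin n → Bool) (c : Bool) :
    rowSigns e i₀ s c i₀ = c := by
  rw [rowSigns, dif_neg (by simpa using hi₀), if_pos rfl]

lemma rowSigns_of_ne {I : Type*} [DecidableEq I] {n : ℕ} {e : Fin n → I} {i₀ : I}
    (s : Fin n → Bool) (c : Bool) {i : I} (h : ∀ j, e j ≠ i) (hi : i ≠ i₀) :
    rowSigns e i₀ s c i = false := by
  rw [rowSigns, dif_neg (by simpa using h), if_neg hi]

/-! ### The expected speed contributed by one neuron. -/

/-- Khintchine's inequality for signed sums with coefficients `wⱼ vⱼ`, linearized in `|wⱼ|`. -/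
lemma khintchine_linearized {n : ℕ} (w : Fin n → ℝ) (v : EuclideanSpace ℝ (Fin n)) :
    2 ^ n * ∑ j, |w j| * (v j ^ 2 / ‖v‖) ≤ √2 * ∑ s, |signedSum (fun j => w j * v j) s| := by
  -- Khintchine leaves √(∑ wⱼ² vⱼ²). Bounding it below by an expression linear in |wⱼ| means that
  -- only E|wⱼ| enters once `v` is independent of the weights.
  refine le_trans ?_ (khintchine fun j => w j * v j)
  refine mul_le_mul_of_nonneg_left ?_ (by positivity)
  -- For `v = 0` the quotients are 0 by the convention for division by zero.
  rcases eq_or_ne v 0 with rfl | hv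
  · simp
  have hv' : 0 < ‖v‖ := norm_pos_iff.2 hv
  simp only [← mul_div_assoc, ← Finset.sum_div]
  rw [div_le_iff₀ hv', EuclideanSpace.norm_eq]
  -- Cauchy–Schwarz pairs |wⱼ vⱼ| with |vⱼ|, whose Euclidean norm is ‖v‖.
  have h := Real.sum_mul_le_sqrt_mul_sqrt Finset.univ (fun j => |w j| * |v j|) (fun j => |v j|)
  refine le_trans (le_of_eq ?_) (h.trans (le_of_eq ?_))
  · refine Finset.sum_congr rfl fun j _ => ?_
    rw [mul_assoc, ← sq, sq_abs]
  · simp [mul_pow]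

/-- The contribution of a single neuron `1_{h > 0} ⟨w, v⟩`, `h = ⟨w, z⟩ + c`, with random
symmetric weights `w` and bias `c` independent of `z` and `v`. -/
lemma le_lintegral_neuron {I : Type*} [Fintype I] [DecidableEq I] {n : ℕ} {e : Fin n → I} {i₀ : I}
    (ρ : I → Measure ℝ) [∀ i, IsProbabilityMeasure (ρ i)] (hρ : ∀ i, (ρ i).map Neg.neg = ρ i)
    (he : Function.Injective e) (hi₀ : ∀ j, e j ≠ i₀) {a : ℝ≥0∞}
    (ha : ∀ j, ∫⁻ c, ‖c‖ₑ ∂ρ (e j) = a) {z v : (I → ℝ) → EuclideanSpace ℝ (Fin n)}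
    (hz : Measurable z) (hv : Measurable v)
    (hzi : ∀ p q, (∀ i, (∀ j, e j ≠ i) → i ≠ i₀ → p i = q i) → z p = z q)
    (hvi : ∀ p q, (∀ i, (∀ j, e j ≠ i) → i ≠ i₀ → p i = q i) → v p = v q)
    (h0 : ∀ᵐ p ∂Measure.pi ρ, ∑ j, p (e j) * z p j + p i₀ = 0 → ∑ j, p (e j) * v p j = 0) :
    a * ∫⁻ p, ‖v p‖ₑ ∂Measure.pi ρ ≤ ENNReal.ofReal (2 * √2) *
      ∫⁻ p, ‖if 0 < ∑ j, p (e j) * z p j + p i₀ then ∑ j, p (e j) * v p j else 0‖ₑ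
        ∂Measure.pi ρ := by
  set h : (I → ℝ) → ℝ := fun p => ∑ j, p (e j) * z p j + p i₀ with hh
  set r : (I → ℝ) → ℝ := fun p => ∑ j, p (e j) * v p j with hr
  have hzm : ∀ j, Measurable fun p => z p j := fun j => by fun_prop
  have hvm : ∀ j, Measurable fun p => v p j := fun j => by fun_prop
  have hhm : Measurable h := by fun_prop
  have hrm : Measurable r := by fun_prop
  -- the sign changes of this row
  let T (s : Fin n → Bool) (c : Bool) (p : I → ℝ) (i : I) : ℝ :=
    bitSign (rowSigns e i₀ s c i) * p i
  have hT (s c) : MeasurePreserving (T s c) (Measure.pi ρ) (Measure.pi ρ) :=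
    measurePreserving_pi_sign ρ hρ _
  have hTw (s c p j) : T s c p (e j) = bitSign (s j) * p (e j) := by
    simp only [T, rowSigns_apply he]
  have hTb (s c p) : T s c p i₀ = bitSign c * p i₀ := by
    simp only [T, rowSigns_bias hi₀]
  have hTo (s c p) (i : I) (hi : ∀ j, e j ≠ i) (hi' : i ≠ i₀) : T s c p i = p i := by
    simp only [T, rowSigns_of_ne s c hi hi', bitSign, Bool.false_eq_true, if_false, one_mul]
  have hTz (s c p) : z (T s c p) = z p := hzi _ _ (hTo s c p)
  have hTv (s c p) : v (T s c p) = v p := hvi _ _ (hTo s c p)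
  -- both signs of `h` contribute equally
  have step₁ : ∫⁻ p, ‖r p‖ₑ ∂Measure.pi ρ =
      2 * ∫⁻ p, ‖if 0 < h p then r p else 0‖ₑ ∂Measure.pi ρ := by
    have e₁ : ∫⁻ p, ‖if h p < 0 then r p else 0‖ₑ ∂Measure.pi ρ =
        ∫⁻ p, ‖if 0 < h p then r p else 0‖ₑ ∂Measure.pi ρ := by
      rw [← (hT (fun _ => true) true).lintegral_comp
        ((Measurable.ite (measurableSet_lt measurable_const hhm) hrm measurable_const).enorm)]
      refine lintegral_congr fun p => ?_
      have t₁ : h (T (fun _ => true) true p) = -h p := by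
        simp only [hh, hTw, hTb, hTz, bitSign, if_true, neg_mul, one_mul,
          Finset.sum_neg_distrib, neg_add]
      have t₂ : r (T (fun _ => true) true p) = -r p := by
        simp only [hr, hTw, hTv, bitSign, if_true, neg_mul, one_mul, Finset.sum_neg_distrib]
      simp only [t₁, t₂, Left.neg_pos_iff]
      split_ifs <;> simp
    rw [two_mul]
    nth_rewrite 1 [← e₁]
    rw [← lintegral_add_left
      ((Measurable.ite (measurableSet_lt hhm measurable_const) hrm measurable_const).enorm)]
    refine lintegral_congr_ae ?_
    filter_upwards [h0] with p hp
    -- Where `h p = 0` both truncated terms vanish, and `h0` makes `r p` vanish too.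
    rcases lt_trichotomy (h p) 0 with hc | hc | hc
    · simp [hc, hc.not_gt]
    · simp [hc, show r p = 0 from hp hc]
    · simp [hc, hc.not_gt]
  -- symmetrization
  have step₂ : ∫⁻ p, ∑ s, ‖signedSum (fun j => p (e j) * v p j) s‖ₑ ∂Measure.pi ρ =
      2 ^ n * ∫⁻ p, ‖r p‖ₑ ∂Measure.pi ρ := by
    have e₂ (s : Fin n → Bool) (p : I → ℝ) :
        signedSum (fun j => p (e j) * v p j) s = r (T s false p) := by
      simp only [hr, signedSum, hTw, hTv, mul_assoc]
    simp only [e₂]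
    rw [lintegral_finsetSum _ fun s _ =>
      show Measurable fun p => ‖r (T s false p)‖ₑ from (hrm.comp (hT s false).measurable).enorm]
    have e₃ (s : Fin n → Bool) : ∫⁻ p, ‖r (T s false p)‖ₑ ∂Measure.pi ρ =
        ∫⁻ p, ‖r p‖ₑ ∂Measure.pi ρ := (hT s false).lintegral_comp hrm.enorm
    simp [e₃]
  -- independence of the weights from `v`
  have step₃ : ∫⁻ p, ∑ j, ‖p (e j)‖ₑ * ENNReal.ofReal (v p j ^ 2 / ‖v p‖) ∂Measure.pi ρ =
      a * ∫⁻ p, ‖v p‖ₑ ∂Measure.pi ρ := by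
    rw [lintegral_finsetSum _ fun j _ => by fun_prop]
    have e₄ (j : Fin n) :
        ∫⁻ p, ‖p (e j)‖ₑ * ENNReal.ofReal (v p j ^ 2 / ‖v p‖) ∂Measure.pi ρ =
          a * ∫⁻ p, ENNReal.ofReal (v p j ^ 2 / ‖v p‖) ∂Measure.pi ρ := by
      rw [← ha j]
      refine lintegral_pi_mul_of_update_eq ρ (e j) (f := fun c => ‖c‖ₑ) (by fun_prop)
        (g := fun p => ENNReal.ofReal (v p j ^ 2 / ‖v p‖)) (by fun_prop) fun p c => ?_
      rw [hvi (Function.update p (e j) c) p fun i hi _ => Function.update_of_ne (hi j).symm _ _]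
    simp only [e₄]
    rw [← Finset.mul_sum, ← lintegral_finsetSum _ fun j _ => by fun_prop]
    congr 1
    refine lintegral_congr fun p => ?_
    rw [← ENNReal.ofReal_sum_of_nonneg fun j _ => by positivity, ← Finset.sum_div,
      ← ofReal_norm]
    congr 1
    rcases eq_or_ne (v p) 0 with hv0 | hv0
    · simp [hv0]
    · rw [div_eq_iff (norm_ne_zero_iff.2 hv0), ← sq, EuclideanSpace.norm_sq_eq]
      simp
  have step₄ : 2 ^ n * ∫⁻ p, ∑ j, ‖p (e j)‖ₑ * ENNReal.ofReal (v p j ^ 2 / ‖v p‖) ∂Measure.pi ρ ≤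
      ENNReal.ofReal √2 *
        ∫⁻ p, ∑ s, ‖signedSum (fun j => p (e j) * v p j) s‖ₑ ∂Measure.pi ρ := by
    rw [← lintegral_const_mul' _ _ (by simp), ← lintegral_const_mul' _ _ ENNReal.ofReal_ne_top]
    refine lintegral_mono fun p => ?_
    have := ENNReal.ofReal_le_ofReal (khintchine_linearized (fun j => p (e j)) (v p))
    rw [ENNReal.ofReal_mul (by positivity), ENNReal.ofReal_mul (by positivity),
      ENNReal.ofReal_sum_of_nonneg (fun _ _ => by positivity),
      ENNReal.ofReal_sum_of_nonneg (fun _ _ => abs_nonneg _)] at this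
    simpa [ENNReal.ofReal_mul, Real.enorm_eq_ofReal_abs] using this
  -- What remains is 2^n a E‖v‖ ≤ √2 · 2^n · 2 · E|r 1_{h > 0}|, and 2^n cancels.
  rw [step₂, step₃, step₁] at step₄
  have h2 : (2 : ℝ≥0∞) ^ n ≠ 0 := by simp
  have h2' : (2 : ℝ≥0∞) ^ n ≠ ∞ := by simp
  rw [← ENNReal.mul_le_mul_iff_right h2 h2']
  refine step₄.trans (le_of_eq ?_)
  rw [ENNReal.ofReal_mul (by norm_num), ENNReal.ofReal_ofNat]
  ring

/-! ### The parameter space and measurability of the layers. -/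

/-- The index set of the scalar parameters in front of the layers `1, …, L`. -/
abbrev ParameterIndex (m : ℕ → ℕ) (L : ℕ) : Type :=
  (Σ ℓ : Fin L, Fin (m (ℓ + 1)) × Fin (m ℓ)) ⊕ (Σ ℓ : Fin L, Fin (m (ℓ + 1)))

/-- The weight matrices with given scalar parameters, extended by zero. -/
def weightsOf {m : ℕ → ℕ} {L : ℕ} (p : ParameterIndex m L → ℝ) : Weights m :=
  fun ℓ => Matrix.of fun i j => if h : ℓ < L then p (.inl ⟨⟨ℓ, h⟩, i, j⟩) else 0

/-- The bias vectors with given scalar parameters, extended by zero. -/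
def biasesOf {m : ℕ → ℕ} {L : ℕ} (p : ParameterIndex m L → ℝ) : Biases m :=
  fun ℓ i => if h : ℓ < L then p (.inr ⟨⟨ℓ, h⟩, i⟩) else 0

variable {m : ℕ → ℕ} {L : ℕ}

lemma weightsOf_apply (p : ParameterIndex m L → ℝ) {ℓ : ℕ} (h : ℓ < L) (i : Fin (m (ℓ + 1)))
    (j : Fin (m ℓ)) : weightsOf p ℓ i j = p (.inl ⟨⟨ℓ, h⟩, i, j⟩) := by
  simp [weightsOf, h]

lemma biasesOf_apply (p : ParameterIndex m L → ℝ) {ℓ : ℕ} (h : ℓ < L) (i : Fin (m (ℓ + 1))) :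
    biasesOf p ℓ i = p (.inr ⟨⟨ℓ, h⟩, i⟩) := by
  simp [biasesOf, h]

lemma weightsOf_parameters {Ω : Type*} (W : Ω → Weights m) (b : Ω → Biases m) (ω : Ω) {ℓ : ℕ}
    (h : ℓ < L) : weightsOf (fun i => parameters L W b i ω) ℓ = W ω ℓ := by
  ext i j
  rw [weightsOf_apply _ h]
  rfl

lemma biasesOf_parameters {Ω : Type*} (W : Ω → Weights m) (b : Ω → Biases m) (ω : Ω) {ℓ : ℕ}
    (h : ℓ < L) : biasesOf (fun i => parameters L W b i ω) ℓ = b ω ℓ := by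
  ext i
  rw [biasesOf_apply _ h]
  rfl

@[fun_prop]
lemma measurable_weightsOf (ℓ : ℕ) (i : Fin (m (ℓ + 1))) (j : Fin (m ℓ)) :
    Measurable fun p : ParameterIndex m L → ℝ => weightsOf p ℓ i j := by
  by_cases h : ℓ < L
  · simp only [weightsOf_apply _ h]
    fun_prop
  · simp [weightsOf, h]

@[fun_prop]
lemma measurable_biasesOf (ℓ : ℕ) (i : Fin (m (ℓ + 1))) :
    Measurable fun p : ParameterIndex m L → ℝ => biasesOf p ℓ i := by
  by_cases h : ℓ < L
  · simp only [biasesOf_apply _ h]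
    fun_prop
  · simp [biasesOf, h]

lemma measurable_mulVec {X : Type*} [MeasurableSpace X] {p : X → ParameterIndex m L → ℝ}
    {d : ℕ} {v : X → EuclideanSpace ℝ (Fin (m d))} (hp : Measurable p) (hv : Measurable v)
    (i : Fin (m (d + 1))) : Measurable fun q => (weightsOf (p q) d *ᵥ (v q).ofLp) i := by
  simp only [Matrix.mulVec, dotProduct]
  have (j : Fin (m d)) : Measurable fun q => weightsOf (p q) d i j := (measurable_weightsOf d i j).comp hp
  fun_prop

lemma measurable_preActivation {X : Type*} [MeasurableSpace X] {p : X → ParameterIndex m L → ℝ}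
    {d : ℕ} {z : X → EuclideanSpace ℝ (Fin (m d))} (hp : Measurable p) (hz : Measurable z)
    (i : Fin (m (d + 1))) :
    Measurable fun q => preActivation (weightsOf (p q) d) (biasesOf (p q) d) (z q) i := by
  simp only [preActivation, Pi.add_apply]
  exact (measurable_mulVec hp hz i).add ((measurable_biasesOf d i).comp hp)

lemma measurable_toLp_comp {X : Type*} [MeasurableSpace X] {n : ℕ} {f : X → Fin n → ℝ}
    (hf : ∀ i, Measurable fun q => f q i) : Measurable fun q => WithLp.toLp 2 (f q) :=
  (PiLp.continuous_toLp 2 _).measurable.comp (measurable_pi_iff.2 hf)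

lemma measurable_layer {X : Type*} [MeasurableSpace X] {p : X → ParameterIndex m L → ℝ}
    {x : X → EuclideanSpace ℝ (Fin (m 0))} (hp : Measurable p) (hx : Measurable x) (d : ℕ) :
    Measurable fun q => layer (weightsOf (p q)) (biasesOf (p q)) (x q) d := by
  induction d with
  | zero => exact hx
  | succ d ih =>
    exact measurable_toLp_comp fun i =>
      (measurable_preActivation hp ih i).max measurable_const

lemma measurable_layerVelocity {X : Type*} [MeasurableSpace X]
    {p : X → ParameterIndex m L → ℝ} {x v : X → EuclideanSpace ℝ (Fin (m 0))}
    (hp : Measurable p) (hx : Measurable x) (hv : Measurable v) (d : ℕ) :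
    Measurable fun q => layerVelocity (weightsOf (p q)) (biasesOf (p q)) (x q) (v q) d := by
  induction d with
  | zero => exact hv
  | succ d ih =>
    exact measurable_toLp_comp fun i => Measurable.ite
      (measurableSet_lt measurable_const (measurable_preActivation hp (measurable_layer hp hx d) i))
      (measurable_mulVec hp ih i) measurable_const

/-! ### Growth of the expected speed from layer to layer. -/

/-- Cauchy–Schwarz: the `ℓ¹` norm is at most `√n` times the Euclidean norm. -/
lemma sum_enorm_le_sqrt_mul_enorm {n : ℕ} (u : EuclideanSpace ℝ (Fin n)) :
    ∑ i, ‖u i‖ₑ ≤ ENNReal.ofReal √(n : ℝ) * ‖u‖ₑ := by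
  simp only [← ofReal_norm]
  rw [← ENNReal.ofReal_sum_of_nonneg fun _ _ => norm_nonneg _,
    ← ENNReal.ofReal_mul (Real.sqrt_nonneg _)]
  refine ENNReal.ofReal_le_ofReal ?_
  have := Real.sum_mul_le_sqrt_mul_sqrt Finset.univ (fun _ => 1) (fun i => ‖u i‖)
  simpa [EuclideanSpace.norm_eq] using this

section Growth

variable {ρ : ParameterIndex m L → Measure ℝ} [∀ i, IsProbabilityMeasure (ρ i)]

/-- The expected speed grows at least by the factor `√k E|w| / (2√2)` from layer to layer, at
inputs for which almost surely no neuron crosses its hyperplane transversally. -/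
lemma le_lintegral_layerVelocity_succ (hρ : ∀ i, (ρ i).map Neg.neg = ρ i) {a : ℝ≥0∞}
    (ha : ∀ q, ∫⁻ c, ‖c‖ₑ ∂ρ (.inl q) = a) (x v : EuclideanSpace ℝ (Fin (m 0))) {d : ℕ}
    (hd : d < L)
    (h0 : ∀ i, ∀ᵐ p ∂Measure.pi ρ,
      preActivation (weightsOf p d) (biasesOf p d) (layer (weightsOf p) (biasesOf p) x d) i = 0 →
      (weightsOf p d *ᵥ (layerVelocity (weightsOf p) (biasesOf p) x v d).ofLp) i = 0) :
    ENNReal.ofReal (√(m (d + 1) : ℝ) / (2 * √2)) * a *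
        ∫⁻ p, ‖layerVelocity (weightsOf p) (biasesOf p) x v d‖ₑ ∂Measure.pi ρ ≤
      ∫⁻ p, ‖layerVelocity (weightsOf p) (biasesOf p) x v (d + 1)‖ₑ ∂Measure.pi ρ := by
  classical
  set X := ∫⁻ p, ‖layerVelocity (weightsOf p) (biasesOf p) x v d‖ₑ ∂Measure.pi ρ with hX
  set Y := ∫⁻ p, ‖layerVelocity (weightsOf p) (biasesOf p) x v (d + 1)‖ₑ ∂Measure.pi ρ with hY
  have hvm (d : ℕ) : Measurable fun p : ParameterIndex m L → ℝ =>
      layerVelocity (weightsOf p) (biasesOf p) x v d :=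
    measurable_layerVelocity measurable_id measurable_const measurable_const d
  have neuron (i : Fin (m (d + 1))) : a * X ≤ ENNReal.ofReal (2 * √2) *
      ∫⁻ p, ‖layerVelocity (weightsOf p) (biasesOf p) x v (d + 1) i‖ₑ ∂Measure.pi ρ := by
    have hpre (p : ParameterIndex m L → ℝ) (u : EuclideanSpace ℝ (Fin (m d))) :
        ∑ j, p (.inl ⟨⟨d, hd⟩, i, j⟩) * u j = (weightsOf p d *ᵥ u.ofLp) i := by
      simp only [Matrix.mulVec, dotProduct, weightsOf_apply _ hd]
    have hbias (p : ParameterIndex m L → ℝ) (u : EuclideanSpace ℝ (Fin (m d))) :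
        (weightsOf p d *ᵥ u.ofLp) i + p (.inr ⟨⟨d, hd⟩, i⟩) =
          preActivation (weightsOf p d) (biasesOf p d) u i := by
      simp only [preActivation, Pi.add_apply, biasesOf_apply _ hd]
    -- Row `i` of layer `d` and its bias do not enter earlier layers, so `z` and `v` ignore these
    -- coordinates.
    have agree (p q : ParameterIndex m L → ℝ)
        (hpq : ∀ l : ParameterIndex m L, (∀ j : Fin (m d), .inl ⟨⟨d, hd⟩, i, j⟩ ≠ l) →
          l ≠ .inr ⟨⟨d, hd⟩, i⟩ → p l = q l) :
        (∀ ℓ < d, weightsOf p ℓ = weightsOf q ℓ) ∧ ∀ ℓ < d, biasesOf p ℓ = biasesOf q ℓ := by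
      constructor
      · intro ℓ hℓ
        ext i' j'
        rw [weightsOf_apply _ (hℓ.trans hd), weightsOf_apply _ (hℓ.trans hd)]
        refine hpq _ (fun j hj => ?_) (by simp)
        have := congrArg (fun s => s.1.1) (Sum.inl.inj hj)
        exact hℓ.ne' this
      · intro ℓ hℓ
        ext i'
        rw [biasesOf_apply _ (hℓ.trans hd), biasesOf_apply _ (hℓ.trans hd)]
        refine hpq _ (fun j hj => by simp at hj) fun hj => ?_
        have := congrArg (fun s => s.1.1) (Sum.inr.inj hj)
        exact hℓ.ne this
    have main := le_lintegral_neuron (e := fun j => (.inl ⟨⟨d, hd⟩, i, j⟩ : ParameterIndex m L))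
      (i₀ := .inr ⟨⟨d, hd⟩, i⟩) ρ hρ (fun j j' hj => by simpa using hj) (fun j => by simp)
      (fun j => ha _) (z := fun p => layer (weightsOf p) (biasesOf p) x d)
      (v := fun p => layerVelocity (weightsOf p) (biasesOf p) x v d)
      (measurable_layer measurable_id measurable_const d) (hvm d)
      (fun p q hpq => layer_congr (agree p q hpq).1 (agree p q hpq).2 x)
      (fun p q hpq => layerVelocity_congr (agree p q hpq).1 (agree p q hpq).2 x v)
      (by simpa only [hpre, hbias] using h0 i)
    simp only [hpre, hbias] at main
    exact main
  have total : (m (d + 1) : ℝ≥0∞) * (a * X) ≤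
      ENNReal.ofReal (2 * √2) * (ENNReal.ofReal √(m (d + 1) : ℝ) * Y) := by
    calc (m (d + 1) : ℝ≥0∞) * (a * X) = ∑ _i : Fin (m (d + 1)), a * X := by simp
      _ ≤ ∑ i, ENNReal.ofReal (2 * √2) * ∫⁻ p,
          ‖layerVelocity (weightsOf p) (biasesOf p) x v (d + 1) i‖ₑ ∂Measure.pi ρ :=
        Finset.sum_le_sum fun i _ => neuron i
      _ = ENNReal.ofReal (2 * √2) * ∫⁻ p, ∑ i,
          ‖layerVelocity (weightsOf p) (biasesOf p) x v (d + 1) i‖ₑ ∂Measure.pi ρ := by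
        have hi (i : Fin (m (d + 1))) : Measurable fun p : ParameterIndex m L → ℝ =>
            layerVelocity (weightsOf p) (biasesOf p) x v (d + 1) i :=
          (measurable_pi_apply i).comp ((PiLp.continuous_ofLp 2 _).measurable.comp (hvm (d + 1)))
        rw [← Finset.mul_sum, lintegral_finsetSum _ fun i _ => (hi i).enorm]
      _ ≤ _ := by
        refine mul_le_mul_right ?_ _
        rw [hY, ← lintegral_const_mul' _ _ ENNReal.ofReal_ne_top]
        exact lintegral_mono fun p => sum_enorm_le_sqrt_mul_enorm _
  -- For width 0 the factor is √0 = 0; otherwise √m may be cancelled from `total`.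
  rcases Nat.eq_zero_or_pos (m (d + 1)) with hk | hk
  · simp [hk]
  have hs : 0 < √(m (d + 1) : ℝ) := Real.sqrt_pos.2 (by exact_mod_cast hk)
  have hc : 0 < 2 * √2 * √(m (d + 1) : ℝ) := by positivity
  rw [← ENNReal.mul_le_mul_iff_right (ENNReal.ofReal_pos.2 hc).ne' ENNReal.ofReal_ne_top]
  refine le_trans (le_of_eq ?_) (total.trans (le_of_eq ?_))
  · rw [← mul_assoc, ← mul_assoc, ← mul_assoc, ← ENNReal.ofReal_mul hc.le,
      ← ENNReal.ofReal_natCast]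
    congr 3
    field_simp
    exact Real.sq_sqrt (by positivity)
  · rw [← mul_assoc, ← ENNReal.ofReal_mul (by positivity)]

lemma pow_mul_le_lintegral_layerVelocity (hρ : ∀ i, (ρ i).map Neg.neg = ρ i) {a : ℝ≥0∞}
    (ha : ∀ q, ∫⁻ c, ‖c‖ₑ ∂ρ (.inl q) = a) {k : ℕ} (hm : ∀ ℓ, 1 ≤ ℓ → ℓ ≤ L → m ℓ = k)
    (x v : EuclideanSpace ℝ (Fin (m 0)))
    (h0 : ∀ d < L, ∀ i, ∀ᵐ p ∂Measure.pi ρ,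
      preActivation (weightsOf p d) (biasesOf p d) (layer (weightsOf p) (biasesOf p) x d) i = 0 →
      (weightsOf p d *ᵥ (layerVelocity (weightsOf p) (biasesOf p) x v d).ofLp) i = 0)
    {d : ℕ} (hd : d ≤ L) :
    (ENNReal.ofReal (√(k : ℝ) / (2 * √2)) * a) ^ d * ‖v‖ₑ ≤
      ∫⁻ p, ‖layerVelocity (weightsOf p) (biasesOf p) x v d‖ₑ ∂Measure.pi ρ := by
  induction d with
  | zero => simp [layerVelocity]
  | succ d ih =>
    have := le_lintegral_layerVelocity_succ hρ ha x v hd (h0 d hd)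
    have hk : (m (d + 1) : ℝ) = k := by rw [hm (d + 1) (by omega) hd]
    rw [hk] at this
    refine le_trans ?_ this
    rw [pow_succ', mul_assoc]
    exact mul_le_mul_right (ih (by omega)) _

/-! ### From speed at a fixed time to length. -/

variable {x : ℝ → EuclideanSpace ℝ (Fin (m 0))}

/-- Replacing `x` by a measurable version makes the integrand jointly measurable in parameters and
time, as Tonelli requires. -/
lemma trajectoryLength_layer (hx : AEDifferentiable x) (W : Weights m) (b : Biases m) (d : ℕ) :
    trajectoryLength (fun t => layer W b (x t) d) =
      ∫⁻ t in Set.Icc (0 : ℝ) 1,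
        ‖layerVelocity W b (hx.aemeasurable.mk x t) (deriv x t) d‖ₑ := by
  refine lintegral_congr_ae ?_
  filter_upwards [ae_hasDerivAt_layer W b hx d, hx.aemeasurable.ae_eq_mk] with t ht ht'
  rw [ht.1.deriv, ← ht']

lemma measurable_uncurry_layerVelocity (hx : AEDifferentiable x) (d : ℕ) :
    Measurable fun q : (ParameterIndex m L → ℝ) × ℝ =>
      layerVelocity (weightsOf q.1) (biasesOf q.1) (hx.aemeasurable.mk x q.2)
        (deriv x q.2) d :=
  measurable_layerVelocity measurable_fst (hx.aemeasurable.measurable_mk.comp measurable_snd)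
    ((measurable_deriv x).comp measurable_snd) d

lemma measurable_trajectoryLength_layer (hx : AEDifferentiable x) (d : ℕ) :
    Measurable fun p : ParameterIndex m L → ℝ =>
      trajectoryLength fun t => layer (weightsOf p) (biasesOf p) (x t) d := by
  simp only [trajectoryLength_layer hx]
  exact (measurable_uncurry_layerVelocity hx d).enorm.lintegral_prod_right'

/-- Exponential lower bound for the expected length of a trajectory in layer `d`, when the
parameters are independent with symmetric laws and all weights have the same `E|w| = a`. -/
theorem pow_mul_trajectoryLength_le (hρ : ∀ i, (ρ i).map Neg.neg = ρ i) {a : ℝ≥0∞}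
    (ha : ∀ q, ∫⁻ c, ‖c‖ₑ ∂ρ (.inl q) = a) {k : ℕ} (hm : ∀ ℓ, 1 ≤ ℓ → ℓ ≤ L → m ℓ = k)
    (hx : AEDifferentiable x) {d : ℕ} (hd : d ≤ L) :
    (ENNReal.ofReal (√(k : ℝ) / (2 * √2)) * a) ^ d * trajectoryLength x ≤
      ∫⁻ p, trajectoryLength (fun t => layer (weightsOf p) (biasesOf p) (x t) d)
        ∂Measure.pi ρ := by
  simp only [trajectoryLength_layer hx]
  rw [lintegral_lintegral_swap (measurable_uncurry_layerVelocity hx d).enorm.aemeasurable,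
    trajectoryLength, ← lintegral_const_mul _ (measurable_deriv x).enorm]
  refine lintegral_mono_ae ?_
  -- For each fixed network the bad times are null; exchanging the quantifiers by Fubini gives, at
  -- almost every time, a null set of bad networks.
  have h0 : ∀ᵐ t ∂(volume.restrict (Set.Icc (0 : ℝ) 1)), ∀ d, ∀ i, ∀ᵐ p ∂Measure.pi ρ,
      preActivation (weightsOf p d) (biasesOf p d)
        (layer (weightsOf p) (biasesOf p) (hx.aemeasurable.mk x t) d) i = 0 →
      (weightsOf p d *ᵥ (layerVelocity (weightsOf p) (biasesOf p)
        (hx.aemeasurable.mk x t) (deriv x t) d).ofLp) i = 0 := by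
    simp only [ae_all_iff]
    intro d i
    have hl : Measurable fun q : (ParameterIndex m L → ℝ) × ℝ =>
        layer (weightsOf q.1) (biasesOf q.1) (hx.aemeasurable.mk x q.2) d :=
      measurable_layer measurable_fst (hx.aemeasurable.measurable_mk.comp measurable_snd) d
    refine (Measure.ae_ae_comm ?_).1 (ae_of_all _ fun p => ?_)
    · exact (measurableSet_eq_fun (measurable_preActivation measurable_fst hl i)
        measurable_const).imp (measurableSet_eq_fun (measurable_mulVec measurable_fst
          (measurable_uncurry_layerVelocity hx d) i) measurable_const)
    · filter_upwards [ae_hasDerivAt_layer (weightsOf p) (biasesOf p) hx d,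
        hx.aemeasurable.ae_eq_mk] with t ht ht'
      rw [← ht']
      exact ht.2 i
  filter_upwards [h0] with t ht
  exact pow_mul_le_lintegral_layerVelocity hρ ha hm _ _ (fun d _ => ht d) hd

end Growth

/-! ### Symmetry and first absolute moments of the weight and bias laws. -/

lemma map_neg_uniformOn {s : Finset ℝ} (hs : ∀ w ∈ s, -w ∈ s) :
    (uniformOn (s : Set ℝ)).map Neg.neg = uniformOn (s : Set ℝ) := by
  ext A hA
  rw [Measure.map_apply measurable_neg hA, uniformOn, cond_apply s.measurableSet,
    cond_apply s.measurableSet]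
  congr 1
  rw [← Measure.count_injective_image neg_injective]
  congr 1
  ext w
  simp only [Set.mem_image, Set.mem_inter_iff, Set.mem_preimage, Finset.mem_coe]
  constructor
  · rintro ⟨u, ⟨hu, huA⟩, rfl⟩
    exact ⟨hs u hu, huA⟩
  · rintro ⟨hw, hwA⟩
    exact ⟨-w, ⟨hs w hw, by simpa using hwA⟩, neg_neg w⟩

lemma map_neg_sparseLaw {α : ℝ} {P : Measure ℝ} (hP : P.map Neg.neg = P) :
    (sparseLaw α P).map Neg.neg = sparseLaw α P := by
  rw [sparseLaw, Measure.map_add _ _ measurable_neg, Measure.map_smul, Measure.map_smul, hP,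
    Measure.map_dirac' measurable_neg, neg_zero]

lemma lintegral_enorm_uniformOn {s : Finset ℝ} (hs : s.Nonempty) :
    ∫⁻ c, ‖c‖ₑ ∂uniformOn (s : Set ℝ) = ENNReal.ofReal ((∑ w ∈ s, |w|) / (s.card : ℝ)) := by
  have hc : (0 : ℝ) < s.card := by exact_mod_cast hs.card_pos
  rw [uniformOn, ProbabilityTheory.cond, lintegral_smul_measure, lintegral_finset, Measure.count_apply_finset,
    div_eq_inv_mul, ENNReal.ofReal_mul (by positivity), ENNReal.ofReal_inv_of_pos hc,
    ENNReal.ofReal_natCast, ENNReal.ofReal_sum_of_nonneg fun _ _ => abs_nonneg _]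
  simp [Real.enorm_eq_ofReal_abs]

lemma lintegral_enorm_sparseLaw (α : ℝ) (P : Measure ℝ) :
    ∫⁻ c, ‖c‖ₑ ∂sparseLaw α P = ENNReal.ofReal α * ∫⁻ c, ‖c‖ₑ ∂P := by
  simp [sparseLaw]

lemma isProbabilityMeasure_sparseLaw {α : ℝ} (hα₀ : 0 ≤ α) (hα₁ : α ≤ 1) (P : Measure ℝ)
    [IsProbabilityMeasure P] : IsProbabilityMeasure (sparseLaw α P) := by
  refine ⟨?_⟩
  simp only [sparseLaw, Measure.add_apply, Measure.smul_apply, measure_univ, smul_eq_mul, mul_one]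
  rw [← ENNReal.ofReal_add hα₀ (by linarith)]
  simp

end ReLUNet

open ReLUNet in
theorem corollary3 {Ω : Type*} [MeasurableSpace Ω] (μ : Measure Ω) [IsProbabilityMeasure μ]
    -- finite symmetric sets of weights and of biases
    (𝒲 ℬ : Finset ℝ) (h𝒲 : 𝒲.Nonempty) (hℬ : ℬ.Nonempty)
    (h𝒲_symm : ∀ w ∈ 𝒲, -w ∈ 𝒲) (hℬ_symm : ∀ c ∈ ℬ, -c ∈ ℬ)
    (α : ℝ) (hα₀ : 0 ≤ α) (hα₁ : α ≤ 1)
    -- depth `L`, input of dimension `m 0`, all other layers of width `k`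
    (L k : ℕ) (m : ℕ → ℕ) (hm : ∀ ℓ, 1 ≤ ℓ → ℓ ≤ L → m ℓ = k)
    (W : Ω → ReLUNet.Weights m) (b : Ω → ReLUNet.Biases m)
    (hnet : ReLUNet.IsRandomSparseNetwork L W b α
      (uniformOn (𝒲 : Set ℝ)) (uniformOn (ℬ : Set ℝ)) μ)
    (x : ℝ → EuclideanSpace ℝ (Fin (m 0))) (hx : ReLUNet.AEDifferentiable x)
    (d : ℕ) (hd : d ≤ L) :
    (∀ ω, ReLUNet.AEDifferentiable fun t => ReLUNet.layer (W ω) (b ω) (x t) d) ∧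
    AEMeasurable
      (fun ω => ReLUNet.trajectoryLength fun t => ReLUNet.layer (W ω) (b ω) (x t) d) μ ∧
    ENNReal.ofReal
        ((α * √(k : ℝ) / (2 * √2) * ((∑ w ∈ 𝒲, |w|) / (𝒲.card : ℝ))) ^ d) *
        ReLUNet.trajectoryLength x ≤
      ∫⁻ ω, ReLUNet.trajectoryLength (fun t => ReLUNet.layer (W ω) (b ω) (x t) d) ∂μ := by
  have hP𝒲 : IsProbabilityMeasure (uniformOn (𝒲 : Set ℝ)) :=
    isProbabilityMeasure_uniformOn 𝒲.finite_toSet h𝒲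
  have hPℬ : IsProbabilityMeasure (uniformOn (ℬ : Set ℝ)) :=
    isProbabilityMeasure_uniformOn ℬ.finite_toSet hℬ
  have hPα := isProbabilityMeasure_sparseLaw hα₀ hα₁ (uniformOn (𝒲 : Set ℝ))
  let ρ : ParameterIndex m L → Measure ℝ :=
    Sum.elim (fun _ => sparseLaw α (uniformOn (𝒲 : Set ℝ))) fun _ => uniformOn (ℬ : Set ℝ)
  have hlaw : ∀ i, HasLaw (parameters L W b i) (ρ i) μ := by
    rintro (q | q)
    · exact hnet.weight_law q.1 q.1.2 _ _
    · exact hnet.bias_law q.1 q.1.2 _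
  have hρ : ∀ i, IsProbabilityMeasure (ρ i) := by rintro (q | q) <;> assumption
  have hρ_symm : ∀ i, (ρ i).map Neg.neg = ρ i := by
    rintro (q | q)
    · exact map_neg_sparseLaw (map_neg_uniformOn h𝒲_symm)
    · exact map_neg_uniformOn hℬ_symm
  have hmeas : ∀ i, AEMeasurable (parameters L W b i) μ := fun i => (hlaw i).aemeasurable
  have hjoint : AEMeasurable (fun ω i => parameters L W b i ω) μ := aemeasurable_pi_iff.2 hmeas
  -- Mutual independence turns the joint law into a product, so the expectation becomes an integral
  -- over parameter space.
  have hmap : μ.map (fun ω i => parameters L W b i ω) = Measure.pi ρ := by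
    rw [(iIndepFun_iff_map_fun_eq_pi_map hmeas).1 hnet.indep]
    simp only [(hlaw _).map_eq]
  have hlen (ω : Ω) : trajectoryLength (fun t => layer (W ω) (b ω) (x t) d) =
      trajectoryLength fun t => layer (weightsOf fun i => parameters L W b i ω)
        (biasesOf fun i => parameters L W b i ω) (x t) d := by
    congr 1
    funext t
    exact layer_congr (fun ℓ hℓ => (weightsOf_parameters W b ω (by omega)).symm)
      (fun ℓ hℓ => (biasesOf_parameters W b ω (by omega)).symm) _
  have hF := measurable_trajectoryLength_layer (L := L) hx d
  refine ⟨fun ω => (ae_hasDerivAt_layer (W ω) (b ω) hx d).mono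
    fun t ht => ht.1.differentiableAt, ?_, ?_⟩
  · simp only [hlen]
    exact hF.comp_aemeasurable hjoint
  · simp only [hlen]
    rw [← lintegral_map' hF.aemeasurable hjoint, hmap]
    -- Here `a` is the mean absolute value of a sparse weight; the atom at 0 contributes nothing.
    refine le_trans (le_of_eq ?_) (pow_mul_trajectoryLength_le (ρ := ρ) hρ_symm
      (a := ENNReal.ofReal (α * ((∑ w ∈ 𝒲, |w|) / (𝒲.card : ℝ)))) (fun q => ?_) hm hx hd)
    · rw [← ENNReal.ofReal_mul (by positivity), ENNReal.ofReal_pow (by positivity)]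
      congr 3
      ring
    · rw [show ρ (.inl q) = sparseLaw α (uniformOn (𝒲 : Set ℝ)) from rfl,
        lintegral_enorm_sparseLaw, lintegral_enorm_uniformOn h𝒲, ENNReal.ofReal_mul hα₀]
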